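/- **System.** Formulas of $\mathsf{MLLP}$ are positive or negative: $P::=X\mid P\otimes P\mid \mathbf 1\mid {\downarrow}N$ and $N::=X^\perp\mid N⅋N\mid\bot\mid{\uparrow}P$, with De Morgan duality $(\cdot)^\perp$ ($\otimes/⅋$, $\mathbf 1/\bot$, $\downarrow/\uparrow$). The rules (besides exchange) are: axiom $\vdash P,P^\perp$; from $\vdash\mathcal M,P$ and $\vdash\mathcal N,Q$ infer $\vdash\mathcal M,\mathcal N,P\otimes Q$; from $\vdash\Gamma,N,M$ infer $\vdash\Gamma,N⅋M$; from $\vdash\mathcal N,N$ infer $\vdash\mathcal N,{\downarrow}N$; from $\vdash\mathcal N,P$ infer $\vdash\mathcal N,{\uparrow}P$; cut: from $\vdash P,\mathcal N$ and $\vdash P^\perp,\Gamma$ infer $\vdash\mathcal N,\Gamma$. Here $P,Q$ are positive, $N,M$ negative, $\mathcal M,\mathcal N$ sequences of negative formulas, and $\Gamma$ has at most one positive formula. $\vdash[\Delta],\Gamma$ is the sequent $\vdash\Gamma$ together with the list $\Delta$ of the pairs $P,P^\perp$ of cut formulas of the proof. **Models.** A *polarized GoI situation* (a model) is a traced symmetric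 monoidal category $(\mathcal C,\otimes,I)$ with zero morphisms, with: an object $U$ and $j:U\otimes U\to U$, $k:U\to U\otimes U$, $k\circ j=\mathrm{Id}$; an object $1$ (in general not $I$) and $r:1\to1\otimes1$, $!:1\otimes1\to1$, $!\circ r=\mathrm{Id}$; a point $\alpha:1\to U$ and $\alpha^*:U\to1$ with $\alpha^*\circ\alpha=\mathrm{Id}$; $r_\alpha:U\to U\otimes1$, $!_\alpha:U\otimes1\to U$ with $!_\alpha\circ r_\alpha=\mathrm{Id}$, $!_\alpha\circ(\alpha\otimes1)=\alpha\circ{!}$, $r_\alpha\circ\alpha=(\alpha\otimes1)\circ r$; such that for every $p:1\to U$, $f\circ(X\otimes p)=(Y\otimes p)\circ g$ implies $\mathsf{Tr}^U_{X,Y}(f)=\mathsf{Tr}^1_{X,Y}(g)$; and $(W\otimes{!_\alpha})\circ(f\otimes0_{1,1})\circ(V\otimes r_\alpha)=f$ for $f:V\otimes U\to W\otimes U$, and likewise with $U,{!_\alpha},r_\alpha$ replaced by $1,{!},r$. **Interpretation of formulas.** $\mathbb 1_A$ is $1$ if $A$ is a literal or begins with a shift, and $\mathbb 1_{A\otimes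 B}=\mathbb 1_{A⅋B}=\mathbb 1_A\otimes\mathbb 1_B$; so $\mathbb 1_A\cong1^m$. $U_A=U$, and $\boldsymbol U_A$ is $U$ on literals, $\boldsymbol U_A\otimes\boldsymbol U_B$ on $A\otimes B$ and $A⅋B$, $\boldsymbol U_{{\downarrow}N}=U\otimes\boldsymbol U_N$, $\boldsymbol U_{{\uparrow}P}=\boldsymbol U_P\otimes U$; $k,j$ induce $k_A:U_A\to\boldsymbol U_A$, $j_A:\boldsymbol U_A\to U_A$ with $k_Aj_A=\mathrm{Id}$. For a sequence take tensor products. The multipoint $\mathsf{mp}(A):\mathbb 1_A\to U_A$ is $\alpha$ on literals, $j\circ(\mathsf{mp}(A)\otimes\mathsf{mp}(B))$ on $A\otimes B$ and $A⅋B$, $\mathsf{mp}({\downarrow}N)=j\circ(\alpha\otimes0_{I,U})$, $\mathsf{mp}({\uparrow}P)=j\circ(0_{I,U}\otimes\alpha)$; for a sequence take tensor products. The constants $\mathbf 1,\bot$ (for which the system has only the axiom) are interpreted as literals. **Interpretation of proofs.** A proof $\pi$ of $\vdash[\Delta],\Gamma$ has an upper layer $[\![\pi]\!]\in\mathrm{End}(U_{\Gamma,\Delta})$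 and a lower layer $f_\pi\in\mathrm{End}(\mathbb 1_{\Gamma,\Delta})$, defined by induction, up to permutation of tensor factors. Let $[\![\pi]\!]^\dagger=k[\![\pi]\!]j\in\mathrm{End}(\boldsymbol U_{\Gamma,\Delta})$; for the connectives $[\![\pi]\!]=j[\![\pi]\!]^\dagger k$. - Axiom: the symmetries $s_{U,U}$ and $s_{\mathbb 1_P,\mathbb 1_{P^\perp}}$ (along De Morgan duality). Cut: $[\![\pi']\!]\otimes[\![\pi'']\!]$, $f_{\pi'}\otimes f_{\pi''}$. $\otimes$: $[\![\pi']\!]^\dagger\otimes[\![\pi'']\!]^\dagger$, $f_{\pi'}\otimes f_{\pi''}$. $⅋$: $[\![\pi']\!]^\dagger$, $f_{\pi'}$. - $\uparrow P$: $[\![\pi]\!]^\dagger=0_{U,U}\otimes[\![\pi']\!]^\dagger$, and $f_\pi=0_{1,1}\otimes f'$, where $f'$ is $f_{\pi'}$ pre- and postcomposed with $0_{I,\mathbb 1_P}$ and $0_{\mathbb 1_P,I}$ on the factor $\mathbb 1_P$. - $\downarrow N$ with side formulas $\mathcal M$, $\mathbb 1_{\mathcal M}\cong1^m$: let $h_m:1\to1^m$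 and $g_m:1^m\to1$ be the iterates of $r$ and $!$ (identities for $m=1$, zero for $m=0$). Then $f_\pi$ is $h_m\otimes f'\otimes g_m$, where $f'$ is $f_{\pi'}$ with the factor $\mathbb 1_N$ removed as above, precomposed with $r^m$ and postcomposed with $!^m$ on the side formulas: the second copy of $\mathbb 1_{\mathcal M}$ produced by $r^m$ is the input of $g_m$, whose output is on $\mathbb 1_{{\downarrow}N}=1$, and the output of $h_m$, whose input is on $\mathbb 1_{{\downarrow}N}$, is the second argument of $!^m$. Likewise $[\![\pi]\!]^\dagger$ is $(h_m\alpha^*)\otimes[\![\pi']\!]^\dagger\otimes(\alpha g_m)$, with $r_\alpha$ and $!_\alpha$ applied on the factors $U$ of $\boldsymbol U_{\mathcal M}$ that come from literals and shifts not in the scope of a shift. With $\sigma$, $\sigma_*$ the tensor products over $\Delta$ of the symmetries on $U\otimes U$, respectively on $\mathbb 1_P\otimes\mathbb 1_{P^\perp}$ (along De Morgan duality), put $\mathsf{Ex}([\![\pi]\!],\sigma)=\mathsf{Tr}^{U_\Delta}((U_\Gamma\otimes\sigma)\circ[\![\pi]\!])$ and $\mathsf{Ex}(f_\pi,\sigma_*)=\mathsf{Tr}^{\mathbb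 1_\Delta}((\mathbb 1_\Gamma\otimes\sigma_*)\circ f_\pi)$. **Proposition (converse of focusing).** Let $\pi$ be an $\mathsf{MLLP}$ proof of $\vdash[\Delta],\mathcal M,A$, where $\mathcal M$ is a (possibly empty) sequence of negative formulas and $A$ contains a polarity shift. Suppose that in every polarized GoI situation the square $$\begin{array}{ccc}U_{\mathcal M,A}&\xrightarrow{\ \mathsf{Ex}([\![\pi]\!],\sigma)\ }&U_{\mathcal M,A}\\ {\scriptstyle\mathsf{mp}(A)}\uparrow&&\uparrow{\scriptstyle\mathsf{mp}(\mathcal M)}\\ \mathbb 1_A&\xrightarrow{\ \mathsf{Ex}(f_\pi,\sigma_*)\ }&\mathbb 1_{\mathcal M}\end{array}$$ commutes, that is: $\mathsf{Ex}(f_\pi,\sigma_*)$ restricted to $\mathbb 1_A$ ranges over $\mathbb 1_{\mathcal M}$ (it is unchanged by composition with $0_{\mathbb 1_A,\mathbb 1_A}\otimes\mathbb 1_{\mathcal M}$), and the two composites $\mathbb 1_A\to U_{\mathcal M,A}$ agree, where restrictions, projections and inclusions are taken along the zero morphisms to and from $I$ on the remaining factors. Suppose further that the square does not commute trivially in all models,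 that is: in at least one polarized GoI situation the composite $\mathbb 1_A\to U_{\mathcal M,A}$ is not the zero morphism. Then $A$ is a positive formula. -/

import Mathlib

open CategoryTheory MonoidalCategory Limits

universe v w t

/-! ## Polarized multiplicative linear logic -/

namespace MLLP

/-- Polarities. -/
inductive Pol : Type
  | pos
  | neg

/-- The opposite polarity. -/
def Pol.op : Pol → Pol
  | .pos => .neg
  | .neg => .pos

/-- Positive formulas `P ::= X | P ⊗ P | 1 | ↓N` and
negative formulas `N ::= X^⊥ | N ⅋ N | ⊥ | ↑P`. -/
inductive Fml (At : Type t) : Pol → Type t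
  | atom (X : At) : Fml At .pos
  | one : Fml At .pos
  | tensor (P Q : Fml At .pos) : Fml At .pos
  | down (N : Fml At .neg) : Fml At .pos
  | natom (X : At) : Fml At .neg
  | bot : Fml At .neg
  | par (N M : Fml At .neg) : Fml At .neg
  | up (P : Fml At .pos) : Fml At .neg

variable {At : Type t}

/-- The De Morgan dual `A^⊥`. -/
def Fml.dual : {p : Pol} → Fml At p → Fml At p.op
  | _, .atom X => .natom X
  | _, .one => .bot
  | _, .tensor P Q => .par P.dual Q.dual
  | _, .down N => .up N.dual
  | _, .natom X => .atom X
  | _, .bot => .one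
  | _, .par N M => .tensor N.dual M.dual
  | _, .up P => .down P.dual

/-- The formula contains a polarity shift `↓` or `↑`. -/
def Fml.HasShift : {p : Pol} → Fml At p → Prop
  | _, .atom _ => False
  | _, .one => False
  | _, .tensor P Q => P.HasShift ∨ Q.HasShift
  | _, .down _ => True
  | _, .natom _ => False
  | _, .bot => False
  | _, .par N M => N.HasShift ∨ M.HasShift
  | _, .up _ => True

/-- The number of literals and shifts that are not in the scope of a shift. -/
def Fml.width : {p : Pol} → Fml At p → ℕ
  | _, .atom _ => 1
  | _, .one => 1
  | _, .tensor P Q => P.width + Q.width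
  | _, .down _ => 1
  | _, .natom _ => 1
  | _, .bot => 1
  | _, .par N M => N.width + M.width
  | _, .up _ => 1

/-- A polarized formula: a positive or a negative one. -/
abbrev Formula (At : Type t) : Type t := Σ p : Pol, Fml At p

/-- A positive formula, as a formula. -/
abbrev pos (P : Fml At .pos) : Formula At := ⟨.pos, P⟩

/-- A negative formula, as a formula. -/
abbrev neg (N : Fml At .neg) : Formula At := ⟨.neg, N⟩

/-- A sequence of negative formulas, as a sequence of formulas. -/
abbrev negs (l : List (Fml At .neg)) : List (Formula At) := l.map neg

/-- The formula is positive. -/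
def Formula.IsPositive (A : Formula At) : Prop := A.1 = Pol.pos

/-- At most one member of the sequence is positive. -/
def AtMostOnePos (Γ : List (Formula At)) : Prop :=
  Γ.Pairwise fun A B => ¬ (Formula.IsPositive A ∧ Formula.IsPositive B)

/-- `Exch Γ Γ'`: the sequence `Γ'` arises from `Γ` by interchanging two neighbours. -/
inductive Exch : List (Formula At) → List (Formula At) → Type t
  | swap (A B : Formula At) (Γ : List (Formula At)) : Exch (A :: B :: Γ) (B :: A :: Γ)
  | cons (A : Formula At) {Γ Γ' : List (Formula At)} (e : Exch Γ Γ') :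
      Exch (A :: Γ) (A :: Γ')

/-- `Proof Δ Γ` is the type of proofs of `⊢ [Δ], Γ`.  An entry `P` of the list `Δ` stands for
the pair `P, P^⊥` of cut formulas of one cut of the proof. -/
inductive Proof : List (Fml At .pos) → List (Formula At) → Type t
  | ax (P : Fml At .pos) : Proof [] [pos P, neg P.dual]
  | cut {Δ₁ Δ₂ : List (Fml At .pos)} {l : List (Fml At .neg)} {Ξ : List (Formula At)}
      (P : Fml At .pos) (hΞ : AtMostOnePos Ξ)
      (π₁ : Proof Δ₁ (pos P :: negs l)) (π₂ : Proof Δ₂ (neg P.dual :: Ξ)) :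
      Proof (P :: (Δ₁ ++ Δ₂)) (negs l ++ Ξ)
  | tensor {Δ₁ Δ₂ : List (Fml At .pos)} {l₁ l₂ : List (Fml At .neg)} (P Q : Fml At .pos)
      (π₁ : Proof Δ₁ (pos P :: negs l₁)) (π₂ : Proof Δ₂ (pos Q :: negs l₂)) :
      Proof (Δ₁ ++ Δ₂) (pos (.tensor P Q) :: (negs l₁ ++ negs l₂))
  | par {Δ : List (Fml At .pos)} {Γ : List (Formula At)} (N M : Fml At .neg)
      (hΓ : AtMostOnePos Γ) (π : Proof Δ (neg N :: neg M :: Γ)) :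
      Proof Δ (neg (.par N M) :: Γ)
  | up {Δ : List (Fml At .pos)} {l : List (Fml At .neg)} (P : Fml At .pos)
      (π : Proof Δ (pos P :: negs l)) : Proof Δ (neg (.up P) :: negs l)
  | down {Δ : List (Fml At .pos)} {l : List (Fml At .neg)} (N : Fml At .neg)
      (π : Proof Δ (neg N :: negs l)) : Proof Δ (pos (.down N) :: negs l)
  | exch {Δ : List (Fml At .pos)} {Γ Γ' : List (Formula At)} (e : Exch Γ Γ')
      (π : Proof Δ Γ) : Proof Δ Γ'

end MLLP

/-! ## Polarized GoI situations -/

/-- A trace (in the sense of Joyal, Street and Verity) on a symmetric monoidal category. -/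
structure MonoidalTrace (C : Type w) [Category.{v} C] [MonoidalCategory C]
    [SymmetricCategory C] where
  tr (U : C) {X Y : C} (f : X ⊗ U ⟶ Y ⊗ U) : X ⟶ Y
  naturality {X X' Y Y' U : C} (a : X' ⟶ X) (f : X ⊗ U ⟶ Y ⊗ U) (b : Y ⟶ Y') :
    tr U (a ▷ U ≫ f ≫ b ▷ U) = a ≫ tr U f ≫ b
  dinaturality {X Y U V : C} (f : X ⊗ U ⟶ Y ⊗ V) (g : V ⟶ U) :
    tr U (f ≫ Y ◁ g) = tr V (X ◁ g ≫ f)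
  vanishing_unit {X Y : C} (f : X ⊗ 𝟙_ C ⟶ Y ⊗ 𝟙_ C) :
    tr (𝟙_ C) f = (ρ_ X).inv ≫ f ≫ (ρ_ Y).hom
  vanishing_tensor {X Y U V : C} (f : X ⊗ (U ⊗ V) ⟶ Y ⊗ (U ⊗ V)) :
    tr (U ⊗ V) f = tr U (tr V ((α_ X U V).hom ≫ f ≫ (α_ Y U V).inv))
  superposing {X Y U : C} (Z : C) (f : X ⊗ U ⟶ Y ⊗ U) :
    tr U ((α_ Z X U).hom ≫ Z ◁ f ≫ (α_ Z Y U).inv) = Z ◁ tr U f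
  yanking (U : C) : tr U (β_ U U).hom = 𝟙 U

/-- A polarized GoI situation on a symmetric monoidal category with zero morphisms. -/
structure PolarizedGoISituation (C : Type w) [Category.{v} C] [MonoidalCategory C]
    [SymmetricCategory C] [HasZeroMorphisms C] extends MonoidalTrace C where
  /-- the reflexive object, with a retraction of `U` onto `U ⊗ U` -/
  U : C
  k : U ⟶ U ⊗ U
  j : U ⊗ U ⟶ U
  j_k : j ≫ k = 𝟙 (U ⊗ U)
  /-- the object written `1` (not the monoidal unit), with a retraction of `1 ⊗ 1` onto `1` -/
  one : C
  bang : one ⊗ one ⟶ one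
  r : one ⟶ one ⊗ one
  r_bang : r ≫ bang = 𝟙 one
  /-- the distinguished point -/
  α : one ⟶ U
  /-- the trace is uniform over all points -/
  uniform (p : one ⟶ U) {X Y : C} (f : X ⊗ U ⟶ Y ⊗ U) (g : X ⊗ one ⟶ Y ⊗ one)
    (h : X ◁ p ≫ f = g ≫ Y ◁ p) : tr U f = tr one g
  /-- lifting of the retraction of `1 ⊗ 1` onto `1` along `α` -/
  bangα : U ⊗ one ⟶ U
  rα : U ⟶ U ⊗ one
  rα_bangα : rα ≫ bangα = 𝟙 U
  lift_bang : α ▷ one ≫ bangα = bang ≫ α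
  lift_r : α ≫ rα = r ≫ α ▷ one
  /-- semi-invertibility of `α` -/
  αstar : U ⟶ one
  α_αstar : α ≫ αstar = 𝟙 one
  /-- the retractions and the zero endomorphism of `1` -/
  zero_U {V W : C} (f : V ⊗ U ⟶ W ⊗ U) :
    V ◁ rα ≫ (α_ V U one).inv ≫ (f ⊗ₘ (0 : one ⟶ one)) ≫ (α_ W U one).hom ≫ W ◁ bangα = f
  zero_one {V W : C} (f : V ⊗ one ⟶ W ⊗ one) :
    V ◁ r ≫ (α_ V one one).inv ≫ (f ⊗ₘ (0 : one ⟶ one)) ≫ (α_ W one one).hom ≫ W ◁ bang = f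

/-! ## Tensor products over lists and permutations of tensor factors -/

namespace MLLP

section Wiring

variable {At : Type t} {C : Type w} [Category.{v} C] [MonoidalCategory C]

/-- The tensor product `T a₁ ⊗ (T a₂ ⊗ (⋯ ⊗ I))` over a list. -/
def tens {ι : Type t} (T : ι → C) : List ι → C
  | [] => 𝟙_ C
  | a :: l => T a ⊗ tens T l

/-- The tensor product of a family of morphisms over a list. -/
def tensMap {ι : Type t} {T T' : ι → C} (φ : ∀ a, T a ⟶ T' a) :
    (l : List ι) → (tens T l ⟶ tens T' l)
  | [] => 𝟙 (𝟙_ C)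
  | a :: l => φ a ⊗ₘ tensMap φ l

/-- The canonical isomorphism for concatenations. -/
def tensAppend {ι : Type t} (T : ι → C) :
    (l l' : List ι) → (tens T (l ++ l') ≅ tens T l ⊗ tens T l')
  | [], l' => (λ_ (tens T l')).symm
  | a :: l, l' => whiskerLeftIso (T a) (tensAppend T l l') ≪≫
      (α_ (T a) (tens T l) (tens T l')).symm

/-- Conjugation of an endomorphism by an isomorphism. -/
def conj {X Y : C} (e : X ≅ Y) (f : Y ⟶ Y) : X ⟶ X := e.hom ≫ f ≫ e.inv

variable [SymmetricCategory C]

/-- The interchange of the two middle factors. -/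
def mid (a b c d : C) : (a ⊗ b) ⊗ (c ⊗ d) ≅ (a ⊗ c) ⊗ (b ⊗ d) where
  hom := tensorμ a b c d
  inv := tensorδ a b c d
  hom_inv_id := tensorμ_tensorδ a b c d
  inv_hom_id := tensorδ_tensorμ a b c d

/-- The permutation of tensor factors given by an exchange. -/
def tensExch (T : Formula At → C) : {Γ Γ' : List (Formula At)} → Exch Γ Γ' →
    (tens T Γ ≅ tens T Γ')
  | _, _, .swap A B Γ => (α_ (T A) (T B) (tens T Γ)).symm ≪≫
      whiskerRightIso (β_ (T A) (T B)) (tens T Γ) ≪≫ α_ (T B) (T A) (tens T Γ)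
  | _, _, .cons A e => whiskerLeftIso (T A) (tensExch T e)

/-- From morphisms `T a ⟶ T a ⊗ L a`, the morphism `T_l ⟶ T_l ⊗ L_l` on lists. -/
def tensDup {ι : Type t} {T L : ι → C} (φ : ∀ a, T a ⟶ T a ⊗ L a) :
    (l : List ι) → (tens T l ⟶ tens T l ⊗ tens L l)
  | [] => (λ_ (𝟙_ C)).inv
  | a :: l => (φ a ⊗ₘ tensDup φ l) ≫ (mid (T a) (L a) (tens T l) (tens L l)).hom

/-- From morphisms `T a ⊗ L a ⟶ T a`, the morphism `T_l ⊗ L_l ⟶ T_l` on lists. -/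
def tensMrg {ι : Type t} {T L : ι → C} (φ : ∀ a, T a ⊗ L a ⟶ T a) :
    (l : List ι) → (tens T l ⊗ tens L l ⟶ tens T l)
  | [] => (λ_ (𝟙_ C)).hom
  | a :: l => (mid (T a) (L a) (tens T l) (tens L l)).inv ≫ (φ a ⊗ₘ tensMrg φ l)

/-- The permutation of the interface for the cut rule: conclusions `A`, `B` of the two premises,
cut formulas `p`, `q`, and previous cuts `d₁`, `d₂`. -/
def cutIso (A B p q d₁ d₂ : C) :
    (A ⊗ B) ⊗ ((p ⊗ q) ⊗ (d₁ ⊗ d₂)) ≅ ((p ⊗ A) ⊗ d₁) ⊗ ((q ⊗ B) ⊗ d₂) :=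
  whiskerLeftIso (A ⊗ B) (mid p q d₁ d₂) ≪≫ mid A B (p ⊗ d₁) (q ⊗ d₂) ≪≫
    (((α_ A p d₁).symm ≪≫ whiskerRightIso (β_ A p) d₁) ⊗ᵢ
      ((α_ B q d₂).symm ≪≫ whiskerRightIso (β_ B q) d₂))

/-- The permutation of the interface for the tensor rule. -/
def tensorIso (A B p q d₁ d₂ : C) :
    ((p ⊗ q) ⊗ (A ⊗ B)) ⊗ (d₁ ⊗ d₂) ≅ ((p ⊗ A) ⊗ d₁) ⊗ ((q ⊗ B) ⊗ d₂) :=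
  whiskerRightIso (mid p q A B) (d₁ ⊗ d₂) ≪≫ mid (p ⊗ A) (q ⊗ B) d₁ d₂

/-- The permutation of tensor factors used in `box`. -/
def boxIso (W A L D : C) : (W ⊗ (A ⊗ L)) ⊗ D ≅ (W ⊗ L) ⊗ (A ⊗ D) :=
  whiskerRightIso (whiskerLeftIso W (β_ A L) ≪≫ (α_ W L A).symm) D ≪≫ α_ (W ⊗ L) A D

/-- The wiring of the `↓` rule, common to the two layers.  The principal wire `W` enters, is sent
by `dn` to `L`, which is merged into the output `A` by `mrg`; the input `A` is split by `dup` into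
`A` and `L`, and this `L` is sent by `dn'` to the output `W`; `f` acts on `A` and `D`. -/
def box {W A L D : C} (dn : W ⟶ L) (dn' : L ⟶ W) (dup : A ⟶ A ⊗ L) (mrg : A ⊗ L ⟶ A)
    (f : A ⊗ D ⟶ A ⊗ D) : (W ⊗ A) ⊗ D ⟶ (W ⊗ A) ⊗ D :=
  (W ◁ dup) ▷ D ≫ (boxIso W A L D).hom ≫ (((dn ⊗ₘ dn') ≫ (β_ L W).hom) ⊗ₘ f) ≫
    (boxIso W A L D).inv ≫ (W ◁ mrg) ▷ D

/-- Restriction to `A` and `D` of an endomorphism of `(X ⊗ A) ⊗ D`, on the input side by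
`0 : I ⟶ X` and on the output side by `0 : X ⟶ I`. -/
def kill [HasZeroMorphisms C] {X A D : C} (f : (X ⊗ A) ⊗ D ⟶ (X ⊗ A) ⊗ D) : A ⊗ D ⟶ A ⊗ D :=
  ((λ_ A).inv ≫ (0 : 𝟙_ C ⟶ X) ▷ A) ▷ D ≫ f ≫ ((0 : X ⟶ 𝟙_ C) ▷ A ≫ (λ_ A).hom) ▷ D

end Wiring

/-! ## The two-layered interpretation -/

section Interpretation

variable {At : Type t} {C : Type w} [Category.{v} C] [MonoidalCategory C] [SymmetricCategory C]
  [HasZeroMorphisms C] (S : PolarizedGoISituation C)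

/-- The power `1^n`. -/
def onePow : ℕ → C
  | 0 => 𝟙_ C
  | n + 1 => onePow n ⊗ S.one

/-- `1^m ⊗ 1^n ≅ 1^(m+n)`. -/
def onePowAdd (m : ℕ) : (n : ℕ) → (onePow S m ⊗ onePow S n ≅ onePow S (m + n))
  | 0 => ρ_ (onePow S m)
  | n + 1 => (α_ (onePow S m) (onePow S n) S.one).symm ≪≫
      whiskerRightIso (onePowAdd m n) S.one

/-- `h_m : 1 ⟶ 1^m`, that is `h_1 = id` and `h_(m+1) = (h_m ⊗ 1) ∘ r`;  for `m = 0` it is zero. -/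
def hMap : (m : ℕ) → (S.one ⟶ onePow S m)
  | 0 => 0
  | 1 => (λ_ S.one).inv
  | m + 2 => S.r ≫ hMap (m + 1) ▷ S.one

/-- `g_m : 1^m ⟶ 1`, that is `g_1 = id` and `g_(m+1) = ! ∘ (g_m ⊗ 1)`;  for `m = 0` it is zero. -/
def gMap : (m : ℕ) → (onePow S m ⟶ S.one)
  | 0 => 0
  | 1 => (λ_ S.one).hom
  | m + 2 => gMap (m + 1) ▷ S.one ≫ S.bang

/-- The object `𝟙_A` of the lower layer. -/
def lowF : {p : Pol} → Fml At p → C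
  | _, .atom _ => S.one
  | _, .one => S.one
  | _, .tensor P Q => lowF P ⊗ lowF Q
  | _, .down _ => S.one
  | _, .natom _ => S.one
  | _, .bot => S.one
  | _, .par N M => lowF N ⊗ lowF M
  | _, .up _ => S.one

/-- `𝟙_A ≅ 1^m`. -/
def lowFlat : {p : Pol} → (A : Fml At p) → (lowF S A ≅ onePow S A.width)
  | _, .atom _ => (λ_ S.one).symm
  | _, .one => (λ_ S.one).symm
  | _, .tensor P Q => (lowFlat P ⊗ᵢ lowFlat Q) ≪≫ onePowAdd S P.width Q.width
  | _, .down _ => (λ_ S.one).symm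
  | _, .natom _ => (λ_ S.one).symm
  | _, .bot => (λ_ S.one).symm
  | _, .par N M => (lowFlat N ⊗ᵢ lowFlat M) ≪≫ onePowAdd S N.width M.width
  | _, .up _ => (λ_ S.one).symm

/-- The permutation `𝟙_A ≅ 𝟙_(A^⊥)` induced by De Morgan duality. -/
def lowDual : {p : Pol} → (A : Fml At p) → (lowF S A ≅ lowF S A.dual)
  | _, .atom _ => Iso.refl S.one
  | _, .one => Iso.refl S.one
  | _, .tensor P Q => lowDual P ⊗ᵢ lowDual Q
  | _, .down _ => Iso.refl S.one
  | _, .natom _ => Iso.refl S.one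
  | _, .bot => Iso.refl S.one
  | _, .par N M => lowDual N ⊗ᵢ lowDual M
  | _, .up _ => Iso.refl S.one

/-- `r^m : 𝟙_A ⟶ 𝟙_A ⊗ 𝟙_A`, where `𝟙_A ≅ 1^m`. -/
def lowDup : {p : Pol} → (A : Fml At p) → (lowF S A ⟶ lowF S A ⊗ lowF S A)
  | _, .atom _ => S.r
  | _, .one => S.r
  | _, .tensor P Q => (lowDup P ⊗ₘ lowDup Q) ≫ (mid (lowF S P) (lowF S P) (lowF S Q) (lowF S Q)).hom
  | _, .down _ => S.r
  | _, .natom _ => S.r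
  | _, .bot => S.r
  | _, .par N M => (lowDup N ⊗ₘ lowDup M) ≫ (mid (lowF S N) (lowF S N) (lowF S M) (lowF S M)).hom
  | _, .up _ => S.r

/-- `!^m : 𝟙_A ⊗ 𝟙_A ⟶ 𝟙_A`, where `𝟙_A ≅ 1^m`. -/
def lowMrg : {p : Pol} → (A : Fml At p) → (lowF S A ⊗ lowF S A ⟶ lowF S A)
  | _, .atom _ => S.bang
  | _, .one => S.bang
  | _, .tensor P Q => (mid (lowF S P) (lowF S P) (lowF S Q) (lowF S Q)).inv ≫ (lowMrg P ⊗ₘ lowMrg Q)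
  | _, .down _ => S.bang
  | _, .natom _ => S.bang
  | _, .bot => S.bang
  | _, .par N M => (mid (lowF S N) (lowF S N) (lowF S M) (lowF S M)).inv ≫ (lowMrg N ⊗ₘ lowMrg M)
  | _, .up _ => S.bang

/-- The unfolded object (the bold `𝐔_A`) of the upper layer. -/
def bold : {p : Pol} → Fml At p → C
  | _, .atom _ => S.U
  | _, .one => S.U
  | _, .tensor P Q => bold P ⊗ bold Q
  | _, .down N => S.U ⊗ bold N
  | _, .natom _ => S.U
  | _, .bot => S.U
  | _, .par N M => bold N ⊗ bold M
  | _, .up P => bold P ⊗ S.U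

/-- The retraction of `U_A = U` onto `𝐔_A`: its section `𝐔_A ⟶ U`. -/
def jF : {p : Pol} → (A : Fml At p) → (bold S A ⟶ S.U)
  | _, .atom _ => 𝟙 S.U
  | _, .one => 𝟙 S.U
  | _, .tensor P Q => (jF P ⊗ₘ jF Q) ≫ S.j
  | _, .down N => S.U ◁ jF N ≫ S.j
  | _, .natom _ => 𝟙 S.U
  | _, .bot => 𝟙 S.U
  | _, .par N M => (jF N ⊗ₘ jF M) ≫ S.j
  | _, .up P => jF P ▷ S.U ≫ S.j

/-- The retraction `U ⟶ 𝐔_A`. -/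
def kF : {p : Pol} → (A : Fml At p) → (S.U ⟶ bold S A)
  | _, .atom _ => 𝟙 S.U
  | _, .one => 𝟙 S.U
  | _, .tensor P Q => S.k ≫ (kF P ⊗ₘ kF Q)
  | _, .down N => S.k ≫ S.U ◁ kF N
  | _, .natom _ => 𝟙 S.U
  | _, .bot => 𝟙 S.U
  | _, .par N M => S.k ≫ (kF N ⊗ₘ kF M)
  | _, .up P => S.k ≫ kF P ▷ S.U

/-- `r̂_A : 𝐔_A ⟶ 𝐔_A ⊗ 𝟙_A`:  `r_α` on the factors `U` of `𝐔_A` that come from literals and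
shifts not in the scope of a shift, and the identity on all other factors. -/
def boldDup : {p : Pol} → (A : Fml At p) → (bold S A ⟶ bold S A ⊗ lowF S A)
  | _, .atom _ => S.rα
  | _, .one => S.rα
  | _, .tensor P Q => (boldDup P ⊗ₘ boldDup Q) ≫
      (mid (bold S P) (lowF S P) (bold S Q) (lowF S Q)).hom
  | _, .down N => S.rα ▷ bold S N ≫ (α_ S.U S.one (bold S N)).hom ≫
      S.U ◁ (β_ S.one (bold S N)).hom ≫ (α_ S.U (bold S N) S.one).inv
  | _, .natom _ => S.rα
  | _, .bot => S.rα
  | _, .par N M => (boldDup N ⊗ₘ boldDup M) ≫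
      (mid (bold S N) (lowF S N) (bold S M) (lowF S M)).hom
  | _, .up P => bold S P ◁ S.rα ≫ (α_ (bold S P) S.U S.one).inv

/-- `!̂_A : 𝐔_A ⊗ 𝟙_A ⟶ 𝐔_A`, the same with `!_α`. -/
def boldMrg : {p : Pol} → (A : Fml At p) → (bold S A ⊗ lowF S A ⟶ bold S A)
  | _, .atom _ => S.bangα
  | _, .one => S.bangα
  | _, .tensor P Q => (mid (bold S P) (lowF S P) (bold S Q) (lowF S Q)).inv ≫
      (boldMrg P ⊗ₘ boldMrg Q)
  | _, .down N => (α_ S.U (bold S N) S.one).hom ≫ S.U ◁ (β_ (bold S N) S.one).hom ≫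
      (α_ S.U S.one (bold S N)).inv ≫ S.bangα ▷ bold S N
  | _, .natom _ => S.bangα
  | _, .bot => S.bangα
  | _, .par N M => (mid (bold S N) (lowF S N) (bold S M) (lowF S M)).inv ≫
      (boldMrg N ⊗ₘ boldMrg M)
  | _, .up P => (α_ (bold S P) S.U S.one).hom ≫ bold S P ◁ S.bangα

/-- The multipoint `mp(A) : 𝟙_A ⟶ U_A` of a formula. -/
def mp : {p : Pol} → (A : Fml At p) → (lowF S A ⟶ S.U)
  | _, .atom _ => S.α
  | _, .one => S.α
  | _, .tensor P Q => (mp P ⊗ₘ mp Q) ≫ S.j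
  | _, .down _ => (ρ_ S.one).inv ≫ (S.α ⊗ₘ (0 : 𝟙_ C ⟶ S.U)) ≫ S.j
  | _, .natom _ => S.α
  | _, .bot => S.α
  | _, .par N M => (mp N ⊗ₘ mp M) ≫ S.j
  | _, .up _ => (λ_ S.one).inv ≫ ((0 : 𝟙_ C ⟶ S.U) ⊗ₘ S.α) ≫ S.j

/-- `𝟙_Γ` for a sequence `Γ`. -/
abbrev low (Γ : List (Formula At)) : C := tens (fun A => lowF S A.2) Γ

/-- `𝟙_Δ` for a list of cut pairs. -/
abbrev lowCut (Δ : List (Fml At .pos)) : C := tens (fun P => lowF S P ⊗ lowF S P.dual) Δ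

/-- `U_Γ` for a sequence `Γ`. -/
abbrev upp (Γ : List (Formula At)) : C := tens (fun _ => S.U) Γ

/-- `U_Δ` for a list of cut pairs. -/
abbrev uppCut (Δ : List (Fml At .pos)) : C := tens (fun _ => S.U ⊗ S.U) Δ

/-- `𝐔_Γ` for a sequence `Γ`. -/
abbrev boldL (Γ : List (Formula At)) : C := tens (fun A => bold S A.2) Γ

/-- `𝐔_Δ` for a list of cut pairs. -/
abbrev boldCut (Δ : List (Fml At .pos)) : C := tens (fun P => bold S P ⊗ bold S P.dual) Δ

/-- `𝟙_Γ ≅ 1^m` for a sequence `Γ`. -/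
def lowFlatL : (Γ : List (Formula At)) → Σ m : ℕ, (low S Γ ≅ onePow S m)
  | [] => ⟨0, Iso.refl (𝟙_ C)⟩
  | A :: Γ => ⟨A.2.width + (lowFlatL Γ).1,
      (lowFlat S A.2 ⊗ᵢ (lowFlatL Γ).2) ≪≫ onePowAdd S A.2.width (lowFlatL Γ).1⟩

/-- `h_m : 1 ⟶ 𝟙_Γ`, where `𝟙_Γ ≅ 1^m`. -/
def hL (Γ : List (Formula At)) : S.one ⟶ low S Γ :=
  hMap S (lowFlatL S Γ).1 ≫ (lowFlatL S Γ).2.inv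

/-- `g_m : 𝟙_Γ ⟶ 1`, where `𝟙_Γ ≅ 1^m`. -/
def gL (Γ : List (Formula At)) : low S Γ ⟶ S.one :=
  (lowFlatL S Γ).2.hom ≫ gMap S (lowFlatL S Γ).1

/-- The crossing of `𝟙_P` and `𝟙_(P^⊥)` along De Morgan duality. -/
def lowCross (P : Fml At .pos) : lowF S P ⊗ lowF S P.dual ⟶ lowF S P ⊗ lowF S P.dual :=
  ((lowDual S P).hom ⊗ₘ (lowDual S P).inv) ≫ (β_ (lowF S P.dual) (lowF S P)).hom

/-- The lower layer `f_π`, an endomorphism of `𝟙_Γ ⊗ 𝟙_Δ`. -/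
def lower : {Δ : List (Fml At .pos)} → {Γ : List (Formula At)} → Proof Δ Γ →
    (low S Γ ⊗ lowCut S Δ ⟶ low S Γ ⊗ lowCut S Δ)
  | _, _, .ax P =>
      conj (ρ_ (lowF S P ⊗ (lowF S P.dual ⊗ 𝟙_ C)) ≪≫
        whiskerLeftIso (lowF S P) (ρ_ (lowF S P.dual))) (lowCross S P)
  | _, _, .cut (Δ₁ := Δ₁) (Δ₂ := Δ₂) (l := l) (Ξ := Ξ) P _ π₁ π₂ =>
      conj ((tensAppend _ (negs l) Ξ ⊗ᵢ
          whiskerLeftIso (lowF S P ⊗ lowF S P.dual) (tensAppend _ Δ₁ Δ₂)) ≪≫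
        cutIso (low S (negs l)) (low S Ξ) (lowF S P) (lowF S P.dual)
          (lowCut S Δ₁) (lowCut S Δ₂))
        (lower π₁ ⊗ₘ lower π₂)
  | _, _, .tensor (Δ₁ := Δ₁) (Δ₂ := Δ₂) (l₁ := l₁) (l₂ := l₂) P Q π₁ π₂ =>
      conj ((whiskerLeftIso (lowF S P ⊗ lowF S Q) (tensAppend _ (negs l₁) (negs l₂)) ⊗ᵢ
          tensAppend _ Δ₁ Δ₂) ≪≫
        tensorIso (low S (negs l₁)) (low S (negs l₂)) (lowF S P) (lowF S Q)
          (lowCut S Δ₁) (lowCut S Δ₂))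
        (lower π₁ ⊗ₘ lower π₂)
  | _, _, .par (Δ := Δ) (Γ := Γ) N M _ π =>
      conj (whiskerRightIso (α_ (lowF S N) (lowF S M) (low S Γ)) (lowCut S Δ)) (lower π)
  | _, _, .up (Δ := Δ) (l := l) P π =>
      conj (α_ S.one (low S (negs l)) (lowCut S Δ))
        ((0 : S.one ⟶ S.one) ⊗ₘ kill (X := lowF S P) (lower π))
  | _, _, .down (l := l) N π =>
      box (hL S (negs l)) (gL S (negs l)) (tensDup (fun A => lowDup S A.2) (negs l))
        (tensMrg (fun A => lowMrg S A.2) (negs l)) (kill (X := lowF S N) (lower π))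
  | _, _, .exch (Δ := Δ) e π =>
      conj (whiskerRightIso (tensExch (fun A => lowF S A.2) e).symm (lowCut S Δ)) (lower π)

/-- The morphism `j_a : 𝐔_(Γ,Δ) ⟶ U_(Γ,Δ)`. -/
def jL (Γ : List (Formula At)) (Δ : List (Fml At .pos)) :
    boldL S Γ ⊗ boldCut S Δ ⟶ upp S Γ ⊗ uppCut S Δ :=
  tensMap (fun A => jF S A.2) Γ ⊗ₘ tensMap (fun P => jF S P ⊗ₘ jF S P.dual) Δ

/-- The morphism `k_a : U_(Γ,Δ) ⟶ 𝐔_(Γ,Δ)`. -/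
def kL (Γ : List (Formula At)) (Δ : List (Fml At .pos)) :
    upp S Γ ⊗ uppCut S Δ ⟶ boldL S Γ ⊗ boldCut S Δ :=
  tensMap (fun A => kF S A.2) Γ ⊗ₘ tensMap (fun P => kF S P ⊗ₘ kF S P.dual) Δ

/-- From an endomorphism of `𝐔_(Γ,Δ)` to one of `U_(Γ,Δ)`: `f ↦ j_a ∘ f ∘ k_a`. -/
def fold {Γ : List (Formula At)} {Δ : List (Fml At .pos)}
    (f : boldL S Γ ⊗ boldCut S Δ ⟶ boldL S Γ ⊗ boldCut S Δ) :
    upp S Γ ⊗ uppCut S Δ ⟶ upp S Γ ⊗ uppCut S Δ :=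
  kL S Γ Δ ≫ f ≫ jL S Γ Δ

/-- From an endomorphism of `U_(Γ,Δ)` to one of `𝐔_(Γ,Δ)`: `f ↦ k_a ∘ f ∘ j_a`. -/
def unfold {Γ : List (Formula At)} {Δ : List (Fml At .pos)}
    (f : upp S Γ ⊗ uppCut S Δ ⟶ upp S Γ ⊗ uppCut S Δ) :
    boldL S Γ ⊗ boldCut S Δ ⟶ boldL S Γ ⊗ boldCut S Δ :=
  jL S Γ Δ ≫ f ≫ kL S Γ Δ

/-- The upper layer `⟦π⟧`, an endomorphism of `U_Γ ⊗ U_Δ`. -/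
def upper : {Δ : List (Fml At .pos)} → {Γ : List (Formula At)} → Proof Δ Γ →
    (upp S Γ ⊗ uppCut S Δ ⟶ upp S Γ ⊗ uppCut S Δ)
  | _, _, .ax _ =>
      conj (ρ_ (S.U ⊗ (S.U ⊗ 𝟙_ C)) ≪≫ whiskerLeftIso S.U (ρ_ S.U)) (β_ S.U S.U).hom
  | _, _, .cut (Δ₁ := Δ₁) (Δ₂ := Δ₂) (l := l) (Ξ := Ξ) _ _ π₁ π₂ =>
      conj ((tensAppend _ (negs l) Ξ ⊗ᵢ
          whiskerLeftIso (S.U ⊗ S.U) (tensAppend _ Δ₁ Δ₂)) ≪≫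
        cutIso (upp S (negs l)) (upp S Ξ) S.U S.U (uppCut S Δ₁) (uppCut S Δ₂))
        (upper π₁ ⊗ₘ upper π₂)
  | _, _, .tensor (Δ₁ := Δ₁) (Δ₂ := Δ₂) (l₁ := l₁) (l₂ := l₂) P Q π₁ π₂ =>
      fold S (Γ := pos (.tensor P Q) :: (negs l₁ ++ negs l₂))
        (conj ((whiskerLeftIso (bold S P ⊗ bold S Q) (tensAppend _ (negs l₁) (negs l₂)) ⊗ᵢ
            tensAppend _ Δ₁ Δ₂) ≪≫
          tensorIso (boldL S (negs l₁)) (boldL S (negs l₂)) (bold S P) (bold S Q)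
            (boldCut S Δ₁) (boldCut S Δ₂))
          (unfold S (upper π₁) ⊗ₘ unfold S (upper π₂)))
  | _, _, .par (Δ := Δ) (Γ := Γ) N M _ π =>
      fold S (Γ := neg (.par N M) :: Γ)
        (conj (whiskerRightIso (α_ (bold S N) (bold S M) (boldL S Γ)) (boldCut S Δ))
          (unfold S (upper π)))
  | _, _, .up (Δ := Δ) (l := l) P π =>
      fold S (Γ := neg (.up P) :: negs l)
        (conj (whiskerRightIso (whiskerRightIso (β_ (bold S P) S.U) (boldL S (negs l)) ≪≫
            α_ S.U (bold S P) (boldL S (negs l))) (boldCut S Δ) ≪≫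
          α_ S.U (bold S P ⊗ boldL S (negs l)) (boldCut S Δ))
          ((0 : S.U ⟶ S.U) ⊗ₘ unfold S (upper π)))
  | _, _, .down (Δ := Δ) (l := l) N π =>
      fold S (Γ := pos (.down N) :: negs l)
        (conj (α_ (S.U ⊗ bold S N) (boldL S (negs l)) (boldCut S Δ) ≪≫
            mid S.U (bold S N) (boldL S (negs l)) (boldCut S Δ))
          (box (S.αstar ≫ hL S (negs l)) (gL S (negs l) ≫ S.α)
            (tensDup (fun A => boldDup S A.2) (negs l))
            (tensMrg (fun A => boldMrg S A.2) (negs l))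
            (conj ((α_ (boldL S (negs l)) (bold S N) (boldCut S Δ)).symm ≪≫
                whiskerRightIso (β_ (boldL S (negs l)) (bold S N)) (boldCut S Δ))
              (unfold S (upper π)))))
  | _, _, .exch (Δ := Δ) e π =>
      conj (whiskerRightIso (tensExch (fun _ => S.U) e).symm (uppCut S Δ)) (upper π)

/-- The execution formula `Ex(⟦π⟧, σ)` of the upper layer. -/
def exUpper {Δ : List (Fml At .pos)} {Γ : List (Formula At)} (π : Proof Δ Γ) :
    upp S Γ ⟶ upp S Γ :=
  S.tr (uppCut S Δ) (upper S π ≫ upp S Γ ◁ tensMap (fun _ => (β_ S.U S.U).hom) Δ)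

/-- The execution formula `Ex(f_π, σ_*)` of the lower layer. -/
def exLower {Δ : List (Fml At .pos)} {Γ : List (Formula At)} (π : Proof Δ Γ) :
    low S Γ ⟶ low S Γ :=
  S.tr (lowCut S Δ) (lower S π ≫ low S Γ ◁ tensMap (fun P => lowCross S P) Δ)

/-! ### The square of multipoints -/

/-- The quasi-injection `X ⟶ X ⊗ Y`. -/
def inj₁ (X Y : C) : X ⟶ X ⊗ Y := (ρ_ X).inv ≫ X ◁ (0 : 𝟙_ C ⟶ Y)

/-- The quasi-injection `Y ⟶ X ⊗ Y`. -/
def inj₂ (X Y : C) : Y ⟶ X ⊗ Y := (λ_ Y).inv ≫ (0 : 𝟙_ C ⟶ X) ▷ Y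

/-- The quasi-projection `X ⊗ Y ⟶ Y`. -/
def proj₂ (X Y : C) : X ⊗ Y ⟶ Y := (0 : X ⟶ 𝟙_ C) ▷ Y ≫ (λ_ Y).hom

variable {Δ : List (Fml At .pos)} {A : Formula At} {l : List (Fml At .neg)}

/-- `mp(A) : 𝟙_A ⟶ U_(A,𝓜)`. -/
def mpHead (A : Formula At) (l : List (Fml At .neg)) : lowF S A.2 ⟶ upp S (A :: negs l) :=
  mp S A.2 ≫ inj₁ S.U (upp S (negs l))

/-- `mp(𝓜) : 𝟙_𝓜 ⟶ U_(A,𝓜)`. -/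
def mpTail (A : Formula At) (l : List (Fml At .neg)) :
    low S (negs l) ⟶ upp S (A :: negs l) :=
  tensMap (fun B => mp S B.2) (negs l) ≫ inj₂ S.U (upp S (negs l))

/-- `Ex(f_π, σ_*)` restricted to `𝟙_A`. -/
def exLowerHead (π : Proof Δ (A :: negs l)) : lowF S A.2 ⟶ low S (A :: negs l) :=
  inj₁ (lowF S A.2) (low S (negs l)) ≫ exLower S π

/-- The bottom arrow `𝟙_A ⟶ 𝟙_𝓜` of the square. -/
def squareBottom (π : Proof Δ (A :: negs l)) : lowF S A.2 ⟶ low S (negs l) :=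
  exLowerHead S π ≫ proj₂ (lowF S A.2) (low S (negs l))

/-- The composite `𝟙_A ⟶ U_(A,𝓜)` of `mp(A)` and `Ex(⟦π⟧, σ)`, the diagonal of the square. -/
def squareDiagonal (π : Proof Δ (A :: negs l)) : lowF S A.2 ⟶ upp S (A :: negs l) :=
  mpHead S A l ≫ exUpper S π

/-- The square commutes: `Ex(f_π, σ_*)` restricted to `𝟙_A` ranges over `𝟙_𝓜`, and
`Ex(⟦π⟧, σ) ∘ mp(A) = mp(𝓜) ∘ Ex(f_π, σ_*)` on `𝟙_A`. -/
def SquareCommutes (π : Proof Δ (A :: negs l)) : Prop :=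
  squareBottom S π ≫ inj₂ (lowF S A.2) (low S (negs l)) = exLowerHead S π ∧
    squareDiagonal S π = squareBottom S π ≫ mpTail S A l

end Interpretation

end MLLP

/-! ## Decompositions of objects into two tensor factors -/

namespace MLLP

section Splitting

variable {C : Type w} [Category.{v} C] [MonoidalCategory C]

/-! Suppose that `A` is negative, so that the whole sequent is. In the lower layer the polarities
orient every proof: negative inputs flow only to positive outputs and positive inputs only to
negative outputs, so `f_π` is, up to symmetry, a tensor product of two independent morphisms. To
express this, each object carries a decomposition into two factors, with negative formulas on the
left as sources and on the right as targets, and conversely for positive ones. Every rule preserves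
this (`IsSplit.lower`).

The cut symmetry matches the outputs of the cut formulas to their inputs, and the trace of a tensor
product of two morphisms is the tensor product of the traces (`MonoidalTrace.tr_mid`, `IsSplit.tr`),
so execution preserves it as well. On a negative sequent the two components are `𝟙_Γ ⟶ I` and `I ⟶
𝟙_Γ`; hence the execution of the lower layer factors through `I` (`exLower_eq_comp`).

By commutativity of the square its diagonal also factors through `I`. The retraction axiom `zero_U`
forces such a morphism to be zero (`comp_eq_zero_of_lowF`), contradicting nontriviality. -/

/-- A decomposition of an object into two tensor factors. -/
structure Splitting (X : C) where
  fst : C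
  snd : C
  iso : X ≅ fst ⊗ snd

/-- A morphism that respects the decompositions of its source and its target. -/
def IsSplit {X Y : C} (s : Splitting X) (t : Splitting Y) (f : X ⟶ Y) : Prop :=
  ∃ (a : s.fst ⟶ t.fst) (b : s.snd ⟶ t.snd), f = s.iso.hom ≫ (a ⊗ₘ b) ≫ t.iso.inv

namespace Splitting

/-- The decomposition `I ≅ I ⊗ I` of the unit. -/
protected def unit : Splitting (𝟙_ C) := ⟨𝟙_ C, 𝟙_ C, (λ_ (𝟙_ C)).symm⟩

/-- The decomposition `X ≅ X ⊗ I`. -/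
protected def left (X : C) : Splitting X := ⟨X, 𝟙_ C, (ρ_ X).symm⟩

/-- The decomposition `X ≅ I ⊗ X`. -/
protected def right (X : C) : Splitting X := ⟨𝟙_ C, X, (λ_ X).symm⟩

end Splitting

theorem IsSplit.id {X : C} (s : Splitting X) : IsSplit s s (𝟙 X) :=
  ⟨𝟙 _, 𝟙 _, by rw [id_tensorHom_id, Category.id_comp, Iso.hom_inv_id]⟩

theorem IsSplit.comp {X Y Z : C} {s : Splitting X} {t : Splitting Y} {u : Splitting Z}
    {f : X ⟶ Y} {g : Y ⟶ Z} (hf : IsSplit s t f) (hg : IsSplit t u g) : IsSplit s u (f ≫ g) := by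
  obtain ⟨a, b, rfl⟩ := hf
  obtain ⟨a', b', rfl⟩ := hg
  exact ⟨a ≫ a', b ≫ b', by
    simp only [Category.assoc, Iso.inv_hom_id_assoc, tensorHom_comp_tensorHom_assoc]⟩

theorem IsSplit.of_left {X Y : C} (f : X ⟶ Y) :
    IsSplit (Splitting.left X) (Splitting.left Y) f :=
  ⟨f, 𝟙 (𝟙_ C), by
    change f = (ρ_ X).inv ≫ (f ⊗ₘ 𝟙 (𝟙_ C)) ≫ (ρ_ Y).hom
    simp⟩

theorem IsSplit.of_right {X Y : C} (f : X ⟶ Y) :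
    IsSplit (Splitting.right X) (Splitting.right Y) f :=
  ⟨𝟙 (𝟙_ C), f, by simp [Splitting.right]⟩

theorem IsSplit.unit_left {X : C} (f : 𝟙_ C ⟶ X) :
    IsSplit Splitting.unit (Splitting.left X) f :=
  ⟨f, 𝟙 (𝟙_ C), by simp [Splitting.left, Splitting.unit, ← unitors_equal]⟩

theorem IsSplit.left_unit {X : C} (f : X ⟶ 𝟙_ C) :
    IsSplit (Splitting.left X) Splitting.unit f :=
  ⟨f, 𝟙 (𝟙_ C), by simp [Splitting.left, Splitting.unit, ← unitors_inv_equal]⟩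

theorem IsSplit.unit_right {X : C} (f : 𝟙_ C ⟶ X) :
    IsSplit Splitting.unit (Splitting.right X) f :=
  ⟨𝟙 (𝟙_ C), f, by simp [Splitting.right, Splitting.unit]⟩

theorem IsSplit.right_unit {X : C} (f : X ⟶ 𝟙_ C) :
    IsSplit (Splitting.right X) Splitting.unit f :=
  ⟨𝟙 (𝟙_ C), f, by simp [Splitting.right, Splitting.unit]⟩

theorem rightUnitor_inv_tensorHom_leftUnitor {X Y : C} (q : X ⟶ 𝟙_ C) (p : 𝟙_ C ⟶ Y) :
    (ρ_ X).inv ≫ (q ⊗ₘ p) ≫ (λ_ Y).hom = q ≫ p := by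
  simp [MonoidalCategory.tensorHom_def, ← unitors_inv_equal]

theorem IsSplit.left_right {X Y : C} (q : X ⟶ 𝟙_ C) (p : 𝟙_ C ⟶ Y) :
    IsSplit (Splitting.left X) (Splitting.right Y) (q ≫ p) :=
  ⟨q, p, (rightUnitor_inv_tensorHom_leftUnitor q p).symm⟩

/-- This is how a decomposition is turned into a factorization through `I`: the left component must
end in `I` and the right one must start there. -/
theorem IsSplit.exists_comp_of_left_right {X Y : C} {f : X ⟶ Y}
    (hf : IsSplit (Splitting.left X) (Splitting.right Y) f) :
    ∃ (q : X ⟶ 𝟙_ C) (p : 𝟙_ C ⟶ Y), f = q ≫ p := by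
  obtain ⟨q, p, rfl⟩ := hf
  exact ⟨q, p, rightUnitor_inv_tensorHom_leftUnitor q p⟩

/-- An isomorphism that, with its inverse, respects the decompositions. -/
def IsSplitIso {X Y : C} (s : Splitting X) (t : Splitting Y) (e : X ≅ Y) : Prop :=
  IsSplit s t e.hom ∧ IsSplit t s e.inv

namespace IsSplitIso

variable {X Y Z : C} {s : Splitting X} {t : Splitting Y} {u : Splitting Z}

theorem symm {e : X ≅ Y} (h : IsSplitIso s t e) : IsSplitIso t s e.symm := ⟨h.2, h.1⟩

theorem refl (s : Splitting X) : IsSplitIso s s (Iso.refl X) := ⟨.id s, .id s⟩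

theorem trans {e : X ≅ Y} {e' : Y ≅ Z} (h : IsSplitIso s t e) (h' : IsSplitIso t u e') :
    IsSplitIso s u (e ≪≫ e') := ⟨h.1.comp h'.1, h'.2.comp h.2⟩

/-- Since `a` and `b` are invertible, a single commuting square settles both `e` and its inverse. -/
theorem of_comp_eq {e : X ≅ Y} (a : s.fst ≅ t.fst) (b : s.snd ≅ t.snd)
    (h : e.hom ≫ t.iso.hom = s.iso.hom ≫ (a.hom ⊗ₘ b.hom)) : IsSplitIso s t e := by
  have h' : e = s.iso ≪≫ (a ⊗ᵢ b) ≪≫ t.iso.symm := by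
    ext
    simp [← reassoc_of% h]
  exact ⟨⟨a.hom, b.hom, by rw [h']; simp⟩, ⟨a.inv, b.inv, by rw [h']; simp⟩⟩

end IsSplitIso

theorem IsSplit.conj {X Y : C} {s s' : Splitting X} {t t' : Splitting Y} {e : X ≅ Y}
    {f : Y ⟶ Y} (h : IsSplitIso s t e) (h' : IsSplitIso s' t' e) (hf : IsSplit t t' f) :
    IsSplit s s' (conj e f) :=
  h.1.comp (hf.comp h'.2)

/-! ### Tensor products of decompositions and the coherence isomorphisms. -/

variable [SymmetricCategory C]

/-- The decomposition of a tensor product. -/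
protected def Splitting.tensor {X Y : C} (s : Splitting X) (t : Splitting Y) :
    Splitting (X ⊗ Y) :=
  ⟨s.fst ⊗ t.fst, s.snd ⊗ t.snd, (s.iso ⊗ᵢ t.iso) ≪≫ mid s.fst s.snd t.fst t.snd⟩

local infixr:70 " ⊠ " => Splitting.tensor

theorem IsSplit.tensor {X Y X' Y' : C} {s : Splitting X} {t : Splitting Y} {s' : Splitting X'}
    {t' : Splitting Y'} {f : X ⟶ Y} {g : X' ⟶ Y'} (hf : IsSplit s t f) (hg : IsSplit s' t' g) :
    IsSplit (s ⊠ s') (t ⊠ t') (f ⊗ₘ g) := by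
  obtain ⟨a, b, rfl⟩ := hf
  obtain ⟨a', b', rfl⟩ := hg
  refine ⟨a ⊗ₘ a', b ⊗ₘ b', ?_⟩
  have h := tensorμ_natural a b a' b'
  simp only [Splitting.tensor, mid, Iso.trans_hom, Iso.trans_inv, tensorIso_hom, tensorIso_inv,
    Category.assoc]
  rw [← reassoc_of% h]
  simp [← tensorHom_comp_tensorHom]

theorem IsSplit.whiskerLeft {X Y X' : C} {s : Splitting X} {t : Splitting Y}
    (s' : Splitting X') {f : X ⟶ Y} (hf : IsSplit s t f) :
    IsSplit (s' ⊠ s) (s' ⊠ t) (X' ◁ f) := by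
  simpa using (IsSplit.id s').tensor hf

theorem IsSplit.whiskerRight {X Y X' : C} {s : Splitting X} {t : Splitting Y}
    (s' : Splitting X') {f : X ⟶ Y} (hf : IsSplit s t f) :
    IsSplit (s ⊠ s') (t ⊠ s') (f ▷ X') := by
  simpa using hf.tensor (IsSplit.id s')

namespace IsSplitIso

variable {X Y Z X' Y' : C} {s : Splitting X} {t : Splitting Y} {u : Splitting Z}
  {s' : Splitting X'} {t' : Splitting Y'}

theorem tensor {e : X ≅ Y} {e' : X' ≅ Y'} (h : IsSplitIso s t e) (h' : IsSplitIso s' t' e') :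
    IsSplitIso (s ⊠ s') (t ⊠ t') (e ⊗ᵢ e') := ⟨h.1.tensor h'.1, h.2.tensor h'.2⟩

theorem whiskerLeft (s' : Splitting X') {e : X ≅ Y} (h : IsSplitIso s t e) :
    IsSplitIso (s' ⊠ s) (s' ⊠ t) (whiskerLeftIso X' e) :=
  ⟨h.1.whiskerLeft s', h.2.whiskerLeft s'⟩

theorem whiskerRight (s' : Splitting X') {e : X ≅ Y} (h : IsSplitIso s t e) :
    IsSplitIso (s ⊠ s') (t ⊠ s') (whiskerRightIso e X') :=
  ⟨h.1.whiskerRight s', h.2.whiskerRight s'⟩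

/-- This and the unitor cases below are the coherence laws that make `⊗` a monoidal functor in two
variables, with `tensorμ` as structure map. -/
theorem associator (s : Splitting X) (t : Splitting Y) (u : Splitting Z) :
    IsSplitIso ((s ⊠ t) ⊠ u) (s ⊠ (t ⊠ u)) (α_ X Y Z) := by
  refine of_comp_eq (α_ s.fst t.fst u.fst) (α_ s.snd t.snd u.snd) ?_
  have h := tensor_associativity s.fst s.snd t.fst t.snd u.fst u.snd
  simp only [Splitting.tensor, mid, Iso.trans_hom, tensorIso_hom, Category.assoc]
  have h₁ : (s.iso.hom ⊗ₘ (t.iso.hom ⊗ₘ u.iso.hom) ≫ tensorμ t.fst t.snd u.fst u.snd) =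
      (s.iso.hom ⊗ₘ (t.iso.hom ⊗ₘ u.iso.hom)) ≫ _ ◁ tensorμ t.fst t.snd u.fst u.snd := by
    rw [← id_tensorHom, tensorHom_comp_tensorHom, Category.comp_id]
  have h₂ : ((s.iso.hom ⊗ₘ t.iso.hom) ≫ tensorμ s.fst s.snd t.fst t.snd ⊗ₘ u.iso.hom) =
      ((s.iso.hom ⊗ₘ t.iso.hom) ⊗ₘ u.iso.hom) ≫ tensorμ s.fst s.snd t.fst t.snd ▷ _ := by
    rw [← tensorHom_id, tensorHom_comp_tensorHom, Category.comp_id]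
  rw [h₁, h₂, Category.assoc, Category.assoc, h, associator_naturality_assoc]

theorem braiding (s : Splitting X) (t : Splitting Y) :
    IsSplitIso (s ⊠ t) (t ⊠ s) (β_ X Y) := by
  refine of_comp_eq (β_ s.fst t.fst) (β_ s.snd t.snd) ?_
  -- Symmetry is essential: the crossing of `a` and `d` is undone by a second crossing, which a mere
  -- braiding does not guarantee.
  have h (a b c d : C) : (β_ (a ⊗ b) (c ⊗ d)).hom ≫ tensorμ c d a b =
      tensorμ a b c d ≫ ((β_ a c).hom ⊗ₘ (β_ b d).hom) := by
    simp [tensorμ, SymmetricCategory.braiding_swap_eq_inv_braiding d a, MonoidalCategory.tensorHom_def]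
  simp only [Splitting.tensor, mid, Iso.trans_hom, tensorIso_hom, Category.assoc]
  rw [← BraidedCategory.braiding_naturality_assoc, h]

theorem leftUnitor (s : Splitting X) :
    IsSplitIso (Splitting.unit ⊠ s) s (λ_ X) := by
  refine of_comp_eq (λ_ s.fst) (λ_ s.snd) ?_
  have h := tensor_left_unitality s.fst s.snd
  simp only [Splitting.tensor, Splitting.unit, mid, Iso.trans_hom, tensorIso_hom, Category.assoc,
    Iso.symm_hom]
  rw [tensorHom_def', Category.assoc, ← h]
  simp

theorem rightUnitor (s : Splitting X) :
    IsSplitIso (s ⊠ Splitting.unit) s (ρ_ X) := by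
  refine of_comp_eq (ρ_ s.fst) (ρ_ s.snd) ?_
  have h := tensor_right_unitality s.fst s.snd
  simp only [Splitting.tensor, Splitting.unit, mid, Iso.trans_hom, tensorIso_hom, Category.assoc,
    Iso.symm_hom]
  rw [MonoidalCategory.tensorHom_def, Category.assoc, ← h]
  simp

/-- A composite formula is decomposed as a whole, whereas its rule treats the two immediate
subformulas separately; this comparison lets the two views be exchanged. -/
theorem left_tensor (X Y : C) :
    IsSplitIso (Splitting.left (X ⊗ Y)) (Splitting.left X ⊠ Splitting.left Y)
      (Iso.refl (X ⊗ Y)) := by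
  refine of_comp_eq (Iso.refl _) (λ_ (𝟙_ C)).symm ?_
  have h := rightUnitor_monoidal X Y
  rw [← cancel_epi ((ρ_ X).hom ⊗ₘ (ρ_ Y).hom)]
  simp only [Splitting.tensor, Splitting.left, mid, Iso.trans_hom, tensorIso_hom, Iso.symm_hom,
    Iso.refl_hom, Category.id_comp]
  nth_rw 2 [h]
  simp

theorem right_tensor (X Y : C) :
    IsSplitIso (Splitting.right (X ⊗ Y)) (Splitting.right X ⊠ Splitting.right Y)
      (Iso.refl (X ⊗ Y)) := by
  refine of_comp_eq (λ_ (𝟙_ C)).symm (Iso.refl _) ?_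
  have h := leftUnitor_monoidal X Y
  rw [← cancel_epi ((λ_ X).hom ⊗ₘ (λ_ Y).hom)]
  simp only [Splitting.tensor, Splitting.right, mid, Iso.trans_hom, tensorIso_hom, Iso.symm_hom,
    Iso.refl_hom, Category.id_comp]
  nth_rw 2 [h]
  simp

theorem middleFour {W X Y Z : C} (s : Splitting W) (t : Splitting X) (u : Splitting Y)
    (s' : Splitting Z) :
    IsSplitIso ((s ⊠ t) ⊠ (u ⊠ s')) ((s ⊠ u) ⊠ (t ⊠ s')) (mid W X Y Z) := by
  have h : mid W X Y Z = α_ W X (Y ⊗ Z) ≪≫ whiskerLeftIso W ((α_ X Y Z).symm ≪≫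
      whiskerRightIso (β_ X Y) Z ≪≫ α_ Y X Z) ≪≫ (α_ W Y (X ⊗ Z)).symm := by
    ext
    simp [mid, tensorμ]
  rw [h]
  exact (associator _ _ _).trans (((((associator _ _ _).symm.trans
    (((braiding t u).whiskerRight s').trans (associator _ _ _))).whiskerLeft s)).trans
      (associator _ _ _).symm)

end IsSplitIso

/-! ### Traces of split morphisms. -/

/-- Vanishing removes `D₂` and then `D₁`; at each stage the factor not involved in the feedback is
pulled out by superposing. -/
theorem _root_.MonoidalTrace.tr_mid (T : MonoidalTrace C) {X₁ X₂ Y₁ Y₂ D₁ D₂ : C}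
    (a : X₁ ⊗ D₁ ⟶ Y₁ ⊗ D₁) (b : X₂ ⊗ D₂ ⟶ Y₂ ⊗ D₂) :
    T.tr (D₁ ⊗ D₂) ((mid X₁ X₂ D₁ D₂).hom ≫ (a ⊗ₘ b) ≫ (mid Y₁ Y₂ D₁ D₂).inv) =
      (T.tr D₁ a ⊗ₘ T.tr D₂ b) := by
  let c (X Y D : C) : (X ⊗ Y) ⊗ D ≅ (X ⊗ D) ⊗ Y :=
    α_ X Y D ≪≫ whiskerLeftIso X (β_ Y D) ≪≫ (α_ X D Y).symm
  have hμ (X Y D E : C) : α_ (X ⊗ Y) D E ≪≫ mid X Y D E =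
      whiskerRightIso (c X Y D) E ≪≫ α_ (X ⊗ D) Y E := by
    ext
    simp [c, mid, tensorμ]
  have hc (X Y D : C) : c X Y D = whiskerRightIso (β_ X Y) D ≪≫ α_ Y X D ≪≫ β_ Y (X ⊗ D) := by
    ext
    simp [c, ← comp_whiskerRight_assoc]
  rw [T.vanishing_tensor]
  have h₁ : (α_ (X₁ ⊗ X₂) D₁ D₂).hom ≫ ((mid X₁ X₂ D₁ D₂).hom ≫ (a ⊗ₘ b) ≫
      (mid Y₁ Y₂ D₁ D₂).inv) ≫ (α_ (Y₁ ⊗ Y₂) D₁ D₂).inv =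
      ((c X₁ X₂ D₁).hom ≫ a ▷ X₂) ▷ D₂ ≫ ((α_ (Y₁ ⊗ D₁) X₂ D₂).hom ≫ (Y₁ ⊗ D₁) ◁ b ≫
        (α_ (Y₁ ⊗ D₁) Y₂ D₂).inv) ≫ (c Y₁ Y₂ D₁).inv ▷ D₂ := by
    have hX := congrArg Iso.hom (hμ X₁ X₂ D₁ D₂)
    have hY := congrArg Iso.inv (hμ Y₁ Y₂ D₁ D₂)
    simp only [Iso.trans_hom, Iso.trans_inv, whiskerRightIso_hom, whiskerRightIso_inv] at hX hY
    simp only [Category.assoc, hY]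
    rw [reassoc_of% hX, MonoidalCategory.tensorHom_def]
    simp
  rw [h₁, T.naturality, T.superposing]
  -- Superposing adds idle factors only on the left, so the two blocks are braided to place the idle
  -- one to the left of `a`.
  have h₂ : ((c X₁ X₂ D₁).hom ≫ a ▷ X₂) ≫ (Y₁ ⊗ D₁) ◁ T.tr D₂ b ≫ (c Y₁ Y₂ D₁).inv =
      ((β_ X₁ X₂).hom ≫ T.tr D₂ b ▷ X₁) ▷ D₁ ≫ ((α_ Y₂ X₁ D₁).hom ≫ Y₂ ◁ a ≫
        (α_ Y₂ Y₁ D₁).inv) ≫ (β_ Y₁ Y₂).inv ▷ D₁ := by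
    have h : (β_ X₂ (X₁ ⊗ D₁)).hom ≫ a ▷ X₂ ≫ (Y₁ ⊗ D₁) ◁ T.tr D₂ b ≫
        (β_ Y₂ (Y₁ ⊗ D₁)).inv = T.tr D₂ b ▷ (X₁ ⊗ D₁) ≫ Y₂ ◁ a := by
      rw [← BraidedCategory.braiding_naturality_right_assoc,
        ← BraidedCategory.braiding_naturality_left_assoc, Iso.hom_inv_id, Category.comp_id,
        whisker_exchange]
    rw [hc, hc]
    simp only [Iso.trans_hom, Iso.trans_inv, whiskerRightIso_hom, whiskerRightIso_inv,
      Category.assoc, comp_whiskerRight, reassoc_of% h, associator_naturality_left_assoc]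
  rw [h₂, T.naturality, T.superposing]
  simp [MonoidalCategory.tensorHom_def']

theorem IsSplit.tr (T : MonoidalTrace C) {X Y D : C} {s : Splitting X} {t : Splitting Y}
    {u : Splitting D} {f : X ⊗ D ⟶ Y ⊗ D} (hf : IsSplit (s ⊠ u) (t ⊠ u) f) :
    IsSplit s t (T.tr D f) := by
  obtain ⟨(a : s.fst ⊗ u.fst ⟶ t.fst ⊗ u.fst), (b : s.snd ⊗ u.snd ⟶ t.snd ⊗ u.snd), rfl⟩ := hf
  refine ⟨T.tr u.fst a, T.tr u.snd b, ?_⟩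
  have e := T.naturality s.iso.hom ((mid s.fst s.snd u.fst u.snd).hom ≫ (a ⊗ₘ b) ≫
    (mid t.fst t.snd u.fst u.snd).inv) t.iso.inv
  rw [T.tr_mid] at e
  refine Eq.trans ?_ e
  -- Dinaturality along `u.iso` replaces the traced object `D` by its decomposed form; naturality
  -- has already absorbed `s.iso` and `t.iso`.
  have h := T.dinaturality (U := D) (V := u.fst ⊗ u.snd)
    (s.iso.hom ▷ D ≫ _ ◁ u.iso.hom ≫ ((mid s.fst s.snd u.fst u.snd).hom ≫ (a ⊗ₘ b) ≫
      (mid t.fst t.snd u.fst u.snd).inv) ≫ t.iso.inv ▷ _) u.iso.inv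
  refine Eq.trans ?_ (h.trans ?_)
  · simp [Splitting.tensor, MonoidalCategory.tensorHom_def]
  · simp [whisker_exchange_assoc]

end Splitting

local infixr:70 " ⊠ " => Splitting.tensor

/-! ### Decompositions determined by polarities, for formulas and lists. -/

section PolaritySplitting

variable {At : Type t} {C : Type w} [Category.{v} C] [MonoidalCategory C]

theorem IsSplit.congr {X Y : C} {s s' : Splitting X} {t t' : Splitting Y} {f : X ⟶ Y}
    (hf : IsSplit s t f) (hs : IsSplitIso s s' (Iso.refl X)) (ht : IsSplitIso t t' (Iso.refl Y)) :
    IsSplit s' t' f := by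
  simpa using hs.2.comp (hf.comp ht.1)

theorem IsSplitIso.congr_source {X Y : C} {s s' : Splitting X} {t : Splitting Y} {e : X ≅ Y}
    (hs : IsSplitIso s s' (Iso.refl X)) (he : IsSplitIso s' t e) : IsSplitIso s t e := by
  simpa using hs.trans he

/-- The decomposition of an object that has its only proper factor on the left if the polarity is
negative, and on the right if it is positive. -/
def polSplit : Pol → (X : C) → Splitting X
  | .pos, X => Splitting.right X
  | .neg, X => Splitting.left X

/-- When source and target lie on the same side, the other component is the identity of `I`, so
nothing is required of `f`. -/
theorem IsSplit.polSplit_polSplit (p : Pol) {X Y : C} (f : X ⟶ Y) :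
    IsSplit (polSplit p X) (polSplit p Y) f := by
  cases p
  · exact .of_right f
  · exact .of_left f

theorem IsSplit.unit_polSplit (p : Pol) {X : C} (f : 𝟙_ C ⟶ X) :
    IsSplit Splitting.unit (polSplit p X) f := by
  cases p
  · exact .unit_right f
  · exact .unit_left f

theorem IsSplit.polSplit_unit (p : Pol) {X : C} (f : X ⟶ 𝟙_ C) :
    IsSplit (polSplit p X) Splitting.unit f := by
  cases p
  · exact .right_unit f
  · exact .left_unit f

theorem IsSplitIso.unit_polSplit (p : Pol) :
    IsSplitIso Splitting.unit (polSplit p (𝟙_ C)) (Iso.refl (𝟙_ C)) :=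
  ⟨.unit_polSplit p _, .polSplit_unit p _⟩

variable [SymmetricCategory C]

theorem IsSplitIso.polSplit_tensor (p : Pol) (X Y : C) :
    IsSplitIso (polSplit p (X ⊗ Y)) (polSplit p X ⊠ polSplit p Y) (Iso.refl (X ⊗ Y)) := by
  cases p
  · exact .right_tensor X Y
  · exact .left_tensor X Y

theorem IsSplitIso.refl_tensor {X Y : C} {s s' : Splitting X} {t t' : Splitting Y}
    (hs : IsSplitIso s s' (Iso.refl X)) (ht : IsSplitIso t t' (Iso.refl Y)) :
    IsSplitIso (s ⊠ t) (s' ⊠ t') (Iso.refl (X ⊗ Y)) :=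
  ⟨by simpa using hs.1.tensor ht.1, by simpa using hs.2.tensor ht.2⟩

/-- The decomposition of a tensor product over a list. -/
def tensSplit {ι : Type t} {T : ι → C} (σ : ∀ a, Splitting (T a)) :
    (l : List ι) → Splitting (tens T l)
  | [] => Splitting.unit
  | a :: l => σ a ⊠ tensSplit σ l

section Lists

variable {ι : Type t} {T T' L : ι → C}

/-- For sequences of a single polarity, such as the negative side formulas: the list may be
decomposed as one block or entry by entry. -/
theorem IsSplitIso.polSplit_tensSplit (p : Pol) (σ : ∀ a, Splitting (T a)) (l : List ι)
    (h : ∀ a ∈ l, σ a = polSplit p (T a)) :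
    IsSplitIso (polSplit p (tens T l)) (tensSplit σ l) (Iso.refl (tens T l)) := by
  induction l with
  | nil => exact (IsSplitIso.unit_polSplit p).symm
  | cons a l ih =>
    rw [tensSplit, h a List.mem_cons_self]
    exact IsSplitIso.congr_source (.polSplit_tensor p (T a) (tens T l))
      (.refl_tensor (.refl _) (ih fun b hb => h b (List.mem_cons_of_mem a hb)))

theorem IsSplit.tensMap {σ : ∀ a, Splitting (T a)} {τ : ∀ a, Splitting (T' a)}
    {φ : ∀ a, T a ⟶ T' a} (h : ∀ a, IsSplit (σ a) (τ a) (φ a)) (l : List ι) :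
    IsSplit (tensSplit σ l) (tensSplit τ l) (tensMap φ l) := by
  induction l with
  | nil => exact .id _
  | cons a l ih => exact (h a).tensor ih

theorem IsSplitIso.tensAppend (σ : ∀ a, Splitting (T a)) (l l' : List ι) :
    IsSplitIso (tensSplit σ (l ++ l')) (tensSplit σ l ⊠ tensSplit σ l') (tensAppend T l l') := by
  induction l with
  | nil => exact (IsSplitIso.leftUnitor _).symm
  | cons a l ih => exact (ih.whiskerLeft (σ a)).trans (IsSplitIso.associator _ _ _).symm

theorem IsSplit.tensDup {σ : ∀ a, Splitting (T a)} {τ : ∀ a, Splitting (L a)}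
    {φ : ∀ a, T a ⟶ T a ⊗ L a} (h : ∀ a, IsSplit (σ a) (σ a ⊠ τ a) (φ a)) (l : List ι) :
    IsSplit (tensSplit σ l) (tensSplit σ l ⊠ tensSplit τ l) (tensDup φ l) := by
  induction l with
  | nil => exact (IsSplitIso.leftUnitor Splitting.unit).2
  | cons a l ih => exact ((h a).tensor ih).comp (IsSplitIso.middleFour _ _ _ _).1

theorem IsSplit.tensMrg {σ : ∀ a, Splitting (T a)} {τ : ∀ a, Splitting (L a)}
    {φ : ∀ a, T a ⊗ L a ⟶ T a} (h : ∀ a, IsSplit (σ a ⊠ τ a) (σ a) (φ a)) (l : List ι) :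
    IsSplit (tensSplit σ l ⊠ tensSplit τ l) (tensSplit σ l) (tensMrg φ l) := by
  induction l with
  | nil => exact (IsSplitIso.leftUnitor Splitting.unit).1
  | cons a l ih => exact (IsSplitIso.middleFour _ _ _ _).2.comp ((h a).tensor ih)

end Lists

theorem IsSplitIso.tensExch {T : Formula At → C} (σ : ∀ A, Splitting (T A))
    {Γ Γ' : List (Formula At)} (e : Exch Γ Γ') :
    IsSplitIso (tensSplit σ Γ) (tensSplit σ Γ') (tensExch T e) := by
  induction e with
  | swap A B Γ =>
    exact (IsSplitIso.associator _ _ _).symm.trans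
      (((IsSplitIso.braiding _ _).whiskerRight _).trans (IsSplitIso.associator _ _ _))
  | cons A e ih => exact ih.whiskerLeft (σ A)

/-! ### Interface permutations and boxes of the rules. -/

section Wiring

variable {A B P Q D E : C} (sA : Splitting A) (sB : Splitting B) (sP : Splitting P)
  (sQ : Splitting Q) (sD : Splitting D) (sE : Splitting E)

theorem IsSplitIso.cutIso :
    IsSplitIso ((sA ⊠ sB) ⊠ ((sP ⊠ sQ) ⊠ (sD ⊠ sE))) (((sP ⊠ sA) ⊠ sD) ⊠ ((sQ ⊠ sB) ⊠ sE))
      (cutIso A B P Q D E) :=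
  ((middleFour _ _ _ _).whiskerLeft _).trans ((middleFour _ _ _ _).trans
    (((associator _ _ _).symm.trans ((braiding _ _).whiskerRight _)).tensor
      ((associator _ _ _).symm.trans ((braiding _ _).whiskerRight _))))

theorem IsSplitIso.tensorIso :
    IsSplitIso (((sP ⊠ sQ) ⊠ (sA ⊠ sB)) ⊠ (sD ⊠ sE)) (((sP ⊠ sA) ⊠ sD) ⊠ ((sQ ⊠ sB) ⊠ sE))
      (tensorIso A B P Q D E) :=
  ((middleFour _ _ _ _).whiskerRight _).trans (middleFour _ _ _ _)

theorem IsSplitIso.boxIso :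
    IsSplitIso ((sP ⊠ (sA ⊠ sB)) ⊠ sD) ((sP ⊠ sB) ⊠ (sA ⊠ sD)) (boxIso P A B D) :=
  ((((braiding _ _).whiskerLeft _).trans (associator _ _ _).symm).whiskerRight _).trans
    (associator _ _ _)

theorem IsSplit.box {W A L D : C} {sW tW : Splitting W} {sA tA : Splitting A}
    {sL tL : Splitting L} {sD tD : Splitting D} {dn : W ⟶ L} {dn' : L ⟶ W} {dup : A ⟶ A ⊗ L}
    {mrg : A ⊗ L ⟶ A} {f : A ⊗ D ⟶ A ⊗ D} (h₁ : IsSplit sW tL dn) (h₂ : IsSplit sL tW dn')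
    (h₃ : IsSplit sA (sA ⊠ sL) dup) (h₄ : IsSplit (tA ⊠ tL) tA mrg)
    (hf : IsSplit (sA ⊠ sD) (tA ⊠ tD) f) :
    IsSplit ((sW ⊠ sA) ⊠ sD) ((tW ⊠ tA) ⊠ tD) (box dn dn' dup mrg f) :=
  ((h₃.whiskerLeft sW).whiskerRight sD).comp ((IsSplitIso.boxIso sA sL sW sD).1.comp
    ((((h₁.tensor h₂).comp (IsSplitIso.braiding tL tW).1).tensor hf).comp
      ((IsSplitIso.boxIso tA tL tW tD).2.comp ((h₄.whiskerLeft tW).whiskerRight tD))))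

/-- The polarities `p` and `q` may differ, as they do for a formula seen as source and as target:
`I` is compatible with either side, so the zero morphisms from and to `I` are too. -/
theorem IsSplit.kill [HasZeroMorphisms C] {p q : Pol} {X A D : C} {sA tA : Splitting A}
    {sD tD : Splitting D} {f : (X ⊗ A) ⊗ D ⟶ (X ⊗ A) ⊗ D}
    (hf : IsSplit ((polSplit p X ⊠ sA) ⊠ sD) ((polSplit q X ⊠ tA) ⊠ tD) f) :
    IsSplit (sA ⊠ sD) (tA ⊠ tD) (kill f) :=
  (((IsSplitIso.leftUnitor sA).2.comp ((IsSplit.unit_polSplit p 0).whiskerRight sA)).whiskerRight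
    sD).comp (hf.comp ((((IsSplit.polSplit_unit q 0).whiskerRight tA).comp
      (IsSplitIso.leftUnitor tA).1).whiskerRight tD))

end Wiring

end PolaritySplitting

/-! ### Orientation of the lower layer by polarity. -/

section LowerLayer

variable {At : Type t} {C : Type w} [Category.{v} C] [MonoidalCategory C] [SymmetricCategory C]
  [HasZeroMorphisms C] (S : PolarizedGoISituation C)

/-- The decomposition of `𝟙_A` as a source: negative formulas are on the left. -/
abbrev inSplit (A : Formula At) : Splitting (lowF S A.2) := polSplit A.1 _

/-- The decomposition of `𝟙_A` as a target: negative formulas are on the right. -/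
abbrev outSplit (A : Formula At) : Splitting (lowF S A.2) := polSplit A.1.op _

/-- The decomposition of a cut pair as a source. -/
abbrev cutInSplit (P : Fml At .pos) : Splitting (lowF S P ⊗ lowF S P.dual) :=
  polSplit .pos _ ⊠ polSplit .neg _

/-- The decomposition of a cut pair as a target. -/
abbrev cutOutSplit (P : Fml At .pos) : Splitting (lowF S P ⊗ lowF S P.dual) :=
  polSplit .neg _ ⊠ polSplit .pos _

/-- With `p` positive this is the axiom link; with `p` negative it is the cut symmetry, returning
outputs of cut formulas to their inputs. -/
theorem IsSplit.lowCross (p q : Pol) (P : Fml At .pos) :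
    IsSplit (polSplit p (lowF S P) ⊠ polSplit q (lowF S P.dual))
      (polSplit q (lowF S P) ⊠ polSplit p (lowF S P.dual)) (lowCross S P) :=
  ((IsSplit.polSplit_polSplit p _).tensor (.polSplit_polSplit q _)).comp
    (IsSplitIso.braiding _ _).1

theorem IsSplitIso.inSplit_negs (l : List (Fml At .neg)) :
    IsSplitIso (polSplit .neg (low S (negs l))) (tensSplit (inSplit S) (negs l)) (Iso.refl _) :=
  .polSplit_tensSplit _ _ _ fun A hA => by
    obtain ⟨N, -, rfl⟩ := List.mem_map.1 hA
    rfl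

theorem IsSplitIso.outSplit_negs (l : List (Fml At .neg)) :
    IsSplitIso (polSplit .pos (low S (negs l))) (tensSplit (outSplit S) (negs l)) (Iso.refl _) :=
  .polSplit_tensSplit _ _ _ fun A hA => by
    obtain ⟨N, -, rfl⟩ := List.mem_map.1 hA
    rfl

/-- The lower layer of a proof sends negative inputs to positive outputs and positive inputs to
negative outputs, without interaction between the two. -/
theorem IsSplit.lower {Δ : List (Fml At .pos)} {Γ : List (Formula At)} (π : Proof Δ Γ) :
    IsSplit (tensSplit (inSplit S) Γ ⊠ tensSplit (cutInSplit S) Δ)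
      (tensSplit (outSplit S) Γ ⊠ tensSplit (cutOutSplit S) Δ) (lower S π) := by
  induction π with
  | ax P =>
    simp only [MLLP.lower]
    have h {p q : Pol} := (IsSplitIso.rightUnitor
      (polSplit p (lowF S P) ⊠ (polSplit q (lowF S P.dual) ⊠ Splitting.unit))).trans
      ((IsSplitIso.rightUnitor _).whiskerLeft _)
    exact (IsSplit.lowCross S .pos .neg P).conj h h
  | @cut Δ₁ Δ₂ l Ξ P hΞ π₁ π₂ ih₁ ih₂ =>
    simp only [MLLP.lower]
    exact (ih₁.tensor ih₂).conj
      (((IsSplitIso.tensAppend _ _ _).tensor ((IsSplitIso.tensAppend _ _ _).whiskerLeft _)).trans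
        (.cutIso _ _ _ _ _ _))
      (((IsSplitIso.tensAppend _ _ _).tensor ((IsSplitIso.tensAppend _ _ _).whiskerLeft _)).trans
        (.cutIso _ _ _ _ _ _))
  | @tensor Δ₁ Δ₂ l₁ l₂ P Q π₁ π₂ ih₁ ih₂ =>
    simp only [MLLP.lower]
    have h (p : Pol) (σ : ∀ A : Formula At, Splitting (lowF S A.2))
        (τ : ∀ P : Fml At .pos, Splitting (lowF S P ⊗ lowF S P.dual)) :=
      IsSplitIso.congr_source (.refl_tensor
        (.refl_tensor (.polSplit_tensor p (lowF S P) (lowF S Q)) (.refl _)) (.refl _))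
        ((((IsSplitIso.tensAppend σ (negs l₁) (negs l₂)).whiskerLeft _).tensor
          (IsSplitIso.tensAppend τ Δ₁ Δ₂)).trans (.tensorIso _ _ _ _ _ _))
    exact (ih₁.tensor ih₂).conj (h .pos _ _) (h .neg _ _)
  | @par Δ Γ N M hΓ π ih =>
    simp only [MLLP.lower]
    exact ih.conj
      (.congr_source (.refl_tensor (.refl_tensor (.polSplit_tensor .neg _ _) (.refl _)) (.refl _))
        ((IsSplitIso.associator _ _ _).whiskerRight _))
      (.congr_source (.refl_tensor (.refl_tensor (.polSplit_tensor .pos _ _) (.refl _)) (.refl _))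
        ((IsSplitIso.associator _ _ _).whiskerRight _))
  | @up Δ l P π ih =>
    simp only [MLLP.lower]
    -- The principal wire of `↑P` enters on the left and leaves on the right; zero is allowed there
    -- because it factors through `I`.
    have h : IsSplit (polSplit .neg S.one) (polSplit .pos S.one) 0 := by
      rw [← zero_comp (f := (0 : 𝟙_ C ⟶ S.one))]
      exact .left_right _ _
    exact (h.tensor ih.kill).conj (.associator _ _ _) (.associator _ _ _)
  | @down Δ l N π ih =>
    simp only [MLLP.lower]
    -- `h_m` goes from the positive input `↓N` to negative outputs and `g_m` from negative inputs to
    -- the positive output, so both respect the orientation.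
    exact IsSplit.box
      ((IsSplit.polSplit_polSplit .pos _).congr (.refl _) (.outSplit_negs S l))
      ((IsSplit.polSplit_polSplit .neg _).congr (.inSplit_negs S l) (.refl _))
      (.tensDup (fun A : Formula At => (IsSplit.polSplit_polSplit A.1 _).congr (.refl _)
        (.polSplit_tensor _ _ _)) _)
      (.tensMrg (fun A : Formula At => (IsSplit.polSplit_polSplit A.1.op _).congr
        (.polSplit_tensor _ _ _) (.refl _)) _)
      ih.kill
  | @exch Δ Γ Γ' e π ih =>
    simp only [MLLP.lower]
    exact ih.conj ((IsSplitIso.tensExch _ e).symm.whiskerRight _)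
      ((IsSplitIso.tensExch _ e).symm.whiskerRight _)

/-- On a sequent of negative formulas, the execution of the lower layer factors through `I`. -/
theorem exLower_eq_comp {Δ : List (Fml At .pos)} {N : List (Fml At .neg)}
    (π : Proof Δ (negs N)) :
    ∃ (q : low S (negs N) ⟶ 𝟙_ C) (p : 𝟙_ C ⟶ low S (negs N)), exLower S π = q ≫ p := by
  have h : IsSplit (tensSplit (inSplit S) (negs N)) (tensSplit (outSplit S) (negs N))
      (exLower S π) :=
    -- After the cut symmetry, the traced object has the same decomposition as source and as target,
    -- as `IsSplit.tr` requires.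
    IsSplit.tr S.toMonoidalTrace ((IsSplit.lower S π).comp
      ((IsSplit.tensMap (fun P => IsSplit.lowCross S .neg .pos P) Δ).whiskerLeft _))
  exact IsSplit.exists_comp_of_left_right
    (h.congr (IsSplitIso.inSplit_negs S N).symm (IsSplitIso.outSplit_negs S N).symm)

theorem squareBottom_eq_comp {Δ : List (Fml At .pos)} {A : Fml At .neg} {l : List (Fml At .neg)}
    (π : Proof Δ (neg A :: negs l)) :
    ∃ (q : lowF S A ⟶ 𝟙_ C) (p : 𝟙_ C ⟶ low S (negs l)), squareBottom S π = q ≫ p := by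
  obtain ⟨(q : lowF S A ⊗ low S (negs l) ⟶ 𝟙_ C), (p : 𝟙_ C ⟶ lowF S A ⊗ low S (negs l)), h⟩ :=
    exLower_eq_comp S (N := A :: l) π
  -- The equation holds over `negs (A :: l)`, which unfolds definitionally to the product appearing
  -- in `squareBottom`.
  have h' : squareBottom S π = (inj₁ (lowF S A) (low S (negs l)) ≫ q ≫ p) ≫ proj₂ _ _ :=
    congrArg (fun f : lowF S A ⊗ low S (negs l) ⟶ lowF S A ⊗ low S (negs l) =>
      (inj₁ _ _ ≫ f) ≫ proj₂ _ _) h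
  exact ⟨inj₁ _ _ ≫ q, p ≫ proj₂ _ _, by simp only [h', Category.assoc]⟩

/-! ### Vanishing of morphisms that factor through `I`. -/

/-- No formula is empty, so its rightmost literal or outermost shift supplies a factor `1`, to which
the vanishing argument can be applied. -/
theorem exists_lowF_iso {p : Pol} (A : Fml At p) : ∃ V : C, Nonempty (lowF S A ≅ V ⊗ S.one) := by
  induction A with
  | tensor P Q _ ih =>
    obtain ⟨V, ⟨e⟩⟩ := ih
    exact ⟨lowF S P ⊗ V, ⟨whiskerLeftIso _ e ≪≫ (α_ _ _ _).symm⟩⟩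
  | par N M _ ih =>
    obtain ⟨V, ⟨e⟩⟩ := ih
    exact ⟨lowF S N ⊗ V, ⟨whiskerLeftIso _ e ≪≫ (α_ _ _ _).symm⟩⟩
  | _ => exact ⟨𝟙_ C, ⟨(λ_ S.one).symm⟩⟩

/-- Endomorphisms that factor through `I` vanish in the presence of a factor `U`. -/
theorem comp_eq_zero_of_tensor_U {V W : C} (q : V ⊗ S.U ⟶ 𝟙_ C) (p : 𝟙_ C ⟶ W ⊗ S.U) :
    q ≫ p = 0 := by
  have h : (q ≫ p) ⊗ₘ (0 : S.one ⟶ S.one) = 0 := by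
    -- Tensoring with a zero morphism need not give zero in general, but tensoring with `I` does;
    -- since `q ≫ p` passes through `I`, the zero can be moved to that stage.
    have h0 : (𝟙_ C) ◁ (0 : S.one ⟶ S.one) = 0 := by
      rw [id_whiskerLeft, zero_comp, comp_zero]
    rw [MonoidalCategory.tensorHom_def, comp_whiskerRight, Category.assoc, ← whisker_exchange,
      h0, zero_comp, comp_zero]
  rw [← S.zero_U (q ≫ p), h]
  simp

/-- The axiom `zero_U` needs a factor `U` at both ends, and the source has only `1`; as `α` is split
by `αstar`, that factor can be routed through `U`. -/
theorem comp_eq_zero_of_lowF {p : Pol} (A : Fml At p) {W : C} (q : lowF S A ⟶ 𝟙_ C)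
    (i : 𝟙_ C ⟶ S.U ⊗ W) : q ≫ i = 0 := by
  obtain ⟨V, ⟨e⟩⟩ := exists_lowF_iso S A
  have h := comp_eq_zero_of_tensor_U S (V ◁ S.αstar ≫ e.inv ≫ q) (i ≫ (β_ S.U W).hom)
  have h' : q ≫ i = e.hom ≫ V ◁ S.α ≫
      ((V ◁ S.αstar ≫ e.inv ≫ q) ≫ i ≫ (β_ S.U W).hom) ≫ (β_ S.U W).inv := by
    simp only [Category.assoc, Iso.hom_inv_id, Category.comp_id]
    rw [← MonoidalCategory.whiskerLeft_comp_assoc, S.α_αstar]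
    simp
  rw [h', h, zero_comp, comp_zero, comp_zero]

end LowerLayer

end MLLP

theorem mainTheorem3 {At : Type t} {Δ : List (MLLP.Fml At .pos)} {A : MLLP.Formula At}
    {M : List (MLLP.Fml At .neg)} (π : MLLP.Proof Δ (A :: MLLP.negs M))
    (hA : A.2.HasShift)
    (hcomm : ∀ (C : Type w) [Category.{v} C] [MonoidalCategory C] [SymmetricCategory C]
      [HasZeroMorphisms C] (S : PolarizedGoISituation C), MLLP.SquareCommutes S π)
    (hnontriv : ∃ (C : Type w) (_ : Category.{v} C) (_ : MonoidalCategory C)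
      (_ : SymmetricCategory C) (_ : HasZeroMorphisms C) (S : PolarizedGoISituation C),
      MLLP.squareDiagonal S π ≠ 0) :
    A.IsPositive := by
  obtain ⟨_ | _, A⟩ := A
  · rfl
  obtain ⟨C, _, _, _, _, S, hS⟩ := hnontriv
  refine absurd ?_ hS
  obtain ⟨q, p, h⟩ := MLLP.squareBottom_eq_comp S π
  -- The multipoint of the side formulas is absorbed into the second half of the factorization,
  -- whose target contains the factor `U` of `A` even when `M` is empty.
  rw [(hcomm C S).2, h, Category.assoc]
  exact MLLP.comp_eq_zero_of_lowF S A _ _
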